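/- Let $\mathcal M$ be the collection of non-empty finite metric spaces. For a finite set $X$ let $\mathrm{pow}(X)$ be the set of its non-empty subsets. A filtration on $X$ is a map $\phi:\mathrm{pow}(X)\to[0,\infty)$ with $\phi(\tau)\le\phi(\sigma)$ whenever $\tau\subseteq\sigma$. The distance between filtered spaces is $$d_{\mathcal F}\big((X,\phi),(Y,\psi)\big)=\inf_{Z,\pi_X,\pi_Y}\ \max_{\sigma\in\mathrm{pow}(Z)}\big|\phi(\pi_X(\sigma))-\psi(\pi_Y(\sigma))\big|,$$ where $Z$ ranges over finite sets and $\pi_X:Z\to X$, $\pi_Y:Z\to Y$ over surjections. A filtration functor $\Phi$ assigns to every $X\in\mathcal M$ a filtration $\Phi_X$ on $X$; it is $1$-stable if $d_{\mathcal F}((X,\Phi_X),(Y,\Phi_Y))\le d_{\mathrm{GH}}(X,Y)$ for all $X,Y\in\mathcal M$, where $d_{\mathrm{GH}}$ is the Gromov–Hausdorff distance. Fix a field $\mathbb K$. For $k\ge 0$ let $\mathrm{dgm}^\Phi_k(X)$ be the persistence diagram (barcode) of the $k$-th simplicial homology, with coefficients in $\mathbb K$, of the filtered simplicial complex $\{\sigma\in\mathrm{pow}(X):\Phi_X(\sigma)\le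 t\}_{t\in\mathbb R}$, and let $d_{\mathrm B}$ be the bottleneck distance. **Proposition.** Let $\Phi$ be a $1$-stable filtration functor such that $\Phi_X(\{x\})=0$ for all $X\in\mathcal M$ and all $x\in X$, and let $k\ge 0$ be an integer. Then there exist two different finite metric spaces $X$ and $Y$, namely a one-point space $X$ and some two-point space $Y$, such that $$d_{\mathrm B}\big(\mathrm{dgm}^\Phi_k(X),\mathrm{dgm}^\Phi_k(Y)\big)<d_{\mathrm{GH}}(X,Y).$$ -/

import Mathlib

open scoped NNReal ENNReal

universe u v w

noncomputable section

namespace FiltFunctor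

/-! ### Finite metric spaces, filtrations, filtration functors -/

/-- A (non-empty) finite metric space. -/
structure FinMet : Type (u + 1) where
  carrier : Type u
  [metric : MetricSpace carrier]
  [finite : Finite carrier]
  [nonempty : Nonempty carrier]

instance : CoeSort FinMet.{u} (Type u) := ⟨FinMet.carrier⟩

attribute [instance] FinMet.metric FinMet.finite FinMet.nonempty

/-- `Pow X` is the set of all finite non-empty subsets of `X`. -/
abbrev Pow (X : Type u) : Type u := {σ : Finset X // σ.Nonempty}

/-- The image of a finite non-empty subset under a map. -/
def Pow.image {Z : Type u} {X : Type v} (f : Z → X) (σ : Pow Z) : Pow X := by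
  classical exact ⟨σ.1.image f, σ.2.image f⟩

/-- A filtration on `X`: a monotone map from `Pow X` to the non-negative reals. -/
structure Filtration (X : Type u) where
  toFun : Pow X → ℝ≥0
  mono : ∀ τ σ : Pow X, τ.1 ⊆ σ.1 → toFun τ ≤ toFun σ

/-- The simplicial complex of all simplices that have arrived at time `t`. -/
def Filtration.complex {X : Type u} (φ : Filtration X) (t : ℝ) :
    PreAbstractSimplicialComplex X where
  faces := {σ | ∃ h : σ.Nonempty, (φ.toFun ⟨σ, h⟩ : ℝ) ≤ t}
  isRelLowerSet_faces := by
    rintro σ ⟨h, ht⟩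
    refine ⟨h, fun τ hτ hne => ⟨hne, le_trans ?_ ht⟩⟩
    exact_mod_cast φ.mono ⟨τ, hne⟩ ⟨σ, h⟩ hτ

theorem Filtration.complex_mono {X : Type u} (φ : Filtration X) {s t : ℝ} (h : s ≤ t) :
    φ.complex s ≤ φ.complex t := by
  rintro σ ⟨hσ, hs⟩
  exact ⟨hσ, hs.trans h⟩

/-- A finite set `Z` with surjections onto `X` and onto `Y`. -/
structure Tripod (X Y : Type u) : Type (u + 1) where
  Z : Type u
  [finite : Finite Z]
  left : Z → X
  right : Z → Y
  left_surj : Function.Surjective left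
  right_surj : Function.Surjective right

/-- The distance between filtered spaces: the infimum over all tripods `X ← Z → Y` of
`max_{σ ⊆ Z} |φ (left σ) - ψ (right σ)|`. -/
def filtDist {X Y : Type u} (φ : Filtration X) (ψ : Filtration Y) : ℝ :=
  ⨅ T : Tripod X Y, ⨆ σ : Pow T.Z,
    |(φ.toFun (σ.image T.left) : ℝ) - (ψ.toFun (σ.image T.right) : ℝ)|

/-- A filtration functor: a choice of a filtration on every finite metric space. -/
def FiltrationFunctor : Type (u + 1) := ∀ X : FinMet.{u}, Filtration X

/-- `L`-stability with respect to the Gromov–Hausdorff distance. -/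
def FiltrationFunctor.IsStable (Φ : FiltrationFunctor.{u}) (L : ℝ≥0) : Prop :=
  ∀ X Y : FinMet.{u}, filtDist (Φ X) (Φ Y) ≤ L * GromovHausdorff.ghDist X Y

/-! ### Simplicial homology with field coefficients

For a finite vertex set `X`, an oriented simplicial `k`-chain is written as the alternating function
of its coefficients: `c (x₀, …, x_k)` is the coefficient of the oriented simplex `[x₀, …, x_k]`.
In this notation the usual boundary `∂[x₀, …, x_k] = ∑ᵢ (-1)ⁱ [x₀, …, x̂ᵢ, …, x_k]` is
`(∂c)(y₀, …, y_{k-1}) = ∑ₓ c (x, y₀, …, y_{k-1})`. -/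

section Homology

variable (𝕜 : Type w) [Field 𝕜] {X : Type u}

/-- The finite set of vertices of a tuple. -/
def vertices {n : ℕ} (x : Fin n → X) : Finset X := by
  classical exact Finset.univ.image x

/-- The oriented simplicial `k`-chains of the complex `K`. -/
def chains (K : PreAbstractSimplicialComplex X) (k : ℕ) :
    Submodule 𝕜 ((Fin (k + 1) → X) → 𝕜) where
  carrier := {c |
    (∀ x, ¬ Function.Injective x → c x = 0) ∧
    (∀ x (π : Equiv.Perm (Fin (k + 1))), c (x ∘ π) = ((Equiv.Perm.sign π : ℤ) : 𝕜) * c x) ∧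
    (∀ x, vertices x ∉ K.faces → c x = 0)}
  add_mem' := by
    rintro a b ⟨ha, ha', ha''⟩ ⟨hb, hb', hb''⟩
    refine ⟨fun x hx => by simp [ha x hx, hb x hx], fun x π => ?_,
      fun x hx => by simp [ha'' x hx, hb'' x hx]⟩
    simp only [Pi.add_apply, ha' x π, hb' x π]
    ring
  zero_mem' := ⟨fun _ _ => rfl, fun _ _ => by simp, fun _ _ => rfl⟩
  smul_mem' := by
    rintro r a ⟨ha, ha', ha''⟩
    refine ⟨fun x hx => by simp [ha x hx], fun x π => ?_, fun x hx => by simp [ha'' x hx]⟩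
    simp only [Pi.smul_apply, smul_eq_mul, ha' x π]
    ring

/-- The boundary map from functions on `(k+2)`-tuples to functions on `(k+1)`-tuples. -/
def boundary [Fintype X] (k : ℕ) :
    ((Fin (k + 2) → X) → 𝕜) →ₗ[𝕜] ((Fin (k + 1) → X) → 𝕜) where
  toFun c := fun y => ∑ x : X, c (Fin.cons x y)
  map_add' a b := by
    funext y
    simp [Finset.sum_add_distrib]
  map_smul' r a := by
    funext y
    simp [Finset.mul_sum]

variable {𝕜}

theorem chains_mono {K L : PreAbstractSimplicialComplex X} (h : K ≤ L) (k : ℕ) :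
    chains 𝕜 K k ≤ chains 𝕜 L k :=
  fun _ hc => ⟨hc.1, hc.2.1, fun x hx => hc.2.2 x fun hK => hx (h hK)⟩

/-- The boundary of a chain is a chain. -/
theorem boundary_mem_chains [Fintype X] (K : PreAbstractSimplicialComplex X) (k : ℕ)
    {c : (Fin (k + 2) → X) → 𝕜} (hc : c ∈ chains 𝕜 K (k + 1)) :
    boundary 𝕜 k c ∈ chains 𝕜 K k := by
  obtain ⟨h1, h2, h3⟩ := hc
  refine ⟨fun y hy => ?_, fun y π => ?_, fun y hy => ?_⟩
  · refine Finset.sum_eq_zero fun x _ => h1 _ fun hinj => hy fun i j hij => ?_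
    have := @hinj i.succ j.succ (by simpa using hij)
    exact Fin.succ_injective _ this
  · change ∑ x : X, c (Fin.cons x (y ∘ π)) = _ * ∑ x : X, c (Fin.cons x y)
    rw [Finset.mul_sum]
    refine Finset.sum_congr rfl fun x _ => ?_
    have h := h2 (Fin.cons x y) (Equiv.Perm.decomposeFin.symm (0, π))
    have he : (Fin.cons x y : Fin (k + 2) → X) ∘ Equiv.Perm.decomposeFin.symm (0, π)
        = Fin.cons x (y ∘ π) := by
      funext i
      refine Fin.cases ?_ (fun j => ?_) i
      · simp
      · simp [Equiv.Perm.decomposeFin_symm_apply_succ]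
    rw [he, Equiv.Perm.decomposeFin.symm_sign] at h
    simpa using h
  · refine Finset.sum_eq_zero fun x _ => h3 _ fun hx => hy ?_
    refine (K.isRelLowerSet_faces hx).2 (fun z hz => ?_) ?_
    · simp only [vertices, Finset.mem_image, Finset.mem_univ, true_and] at hz ⊢
      obtain ⟨i, rfl⟩ := hz
      exact ⟨i.succ, by simp⟩
    · exact ⟨y 0, by simp [vertices]⟩

/-- The boundary of the boundary of a chain vanishes. -/
theorem boundary_boundary [Fintype X] (K : PreAbstractSimplicialComplex X) (k : ℕ)
    {c : (Fin (k + 3) → X) → 𝕜} (hc : c ∈ chains 𝕜 K (k + 2)) :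
    boundary 𝕜 k (boundary 𝕜 (k + 1) c) = 0 := by
  obtain ⟨h1, h2, -⟩ := hc
  funext y
  change ∑ x : X, ∑ x' : X, c (Fin.cons x' (Fin.cons x y)) = 0
  rw [← Finset.sum_product' Finset.univ Finset.univ
    (fun x x' => c (Fin.cons x' (Fin.cons x y)))]
  refine Finset.sum_involution (fun p _ => (p.2, p.1)) ?_ ?_ (by simp) (by simp)
  · rintro ⟨x, x'⟩ -
    have h := h2 (Fin.cons x' (Fin.cons x y)) (Equiv.swap 0 1)
    have he : (Fin.cons x' (Fin.cons x y) : Fin (k + 3) → X) ∘ Equiv.swap 0 1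
        = Fin.cons x (Fin.cons x' y) := by
      funext i
      refine Fin.cases ?_ (fun j => ?_) i
      · simp
      · refine Fin.cases ?_ (fun l => ?_) j
        · simp
        · rw [Function.comp_apply, Equiv.swap_apply_of_ne_of_ne]
          · simp
          · exact Fin.succ_ne_zero _
          · intro hl
            exact Fin.succ_ne_zero l (Fin.succ_injective _ hl)
    rw [he] at h
    simp [h]
  · rintro ⟨x, x'⟩ - hne heq
    refine hne (h1 _ fun hinj => ?_)
    have hx : x' = x := (Prod.mk.inj heq).1
    have := @hinj 0 1 (by simp [hx])
    simp at this

/-- The `k`-cycles of `K`. -/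
def cycles [Fintype X] (K : PreAbstractSimplicialComplex X) :
    (k : ℕ) → Submodule 𝕜 ((Fin (k + 1) → X) → 𝕜)
  | 0 => chains 𝕜 K 0
  | k + 1 => chains 𝕜 K (k + 1) ⊓ LinearMap.ker (boundary 𝕜 k)

/-- The `k`-boundaries of `K`. -/
def boundaries [Fintype X] (K : PreAbstractSimplicialComplex X) (k : ℕ) :
    Submodule 𝕜 ((Fin (k + 1) → X) → 𝕜) :=
  (chains 𝕜 K (k + 1)).map (boundary 𝕜 k)

theorem cycles_mono [Fintype X] {K L : PreAbstractSimplicialComplex X} (h : K ≤ L) (k : ℕ) :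
    cycles (𝕜 := 𝕜) K k ≤ cycles L k := by
  cases k with
  | zero => exact chains_mono h 0
  | succ k => exact inf_le_inf_right _ (chains_mono h (k + 1))

theorem boundaries_mono [Fintype X] {K L : PreAbstractSimplicialComplex X} (h : K ≤ L) (k : ℕ) :
    boundaries (𝕜 := 𝕜) K k ≤ boundaries L k :=
  Submodule.map_mono (chains_mono h (k + 1))

theorem boundaries_le_cycles [Fintype X] (K : PreAbstractSimplicialComplex X) (k : ℕ) :
    boundaries (𝕜 := 𝕜) K k ≤ cycles K k := by
  rintro _ ⟨c, hc, rfl⟩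
  cases k with
  | zero => exact boundary_mem_chains K 0 hc
  | succ k => exact ⟨boundary_mem_chains K (k + 1) hc, boundary_boundary K k hc⟩

variable (𝕜)

/-- The `k`-th (unreduced) simplicial homology `H_k(K; 𝕜)`: cycles modulo boundaries. -/
abbrev homology [Fintype X] (K : PreAbstractSimplicialComplex X) (k : ℕ) : Type (max u w) :=
  cycles (𝕜 := 𝕜) K k ⧸ (boundaries (𝕜 := 𝕜) K k).submoduleOf (cycles K k)

/-- The map in homology induced by the inclusion of a subcomplex. -/
def homologyMap [Fintype X] {K L : PreAbstractSimplicialComplex X} (h : K ≤ L) (k : ℕ) :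
    homology 𝕜 K k →ₗ[𝕜] homology 𝕜 L k :=
  Submodule.mapQ _ _ (Submodule.inclusion (cycles_mono h k))
    (fun _ hc => boundaries_mono h k hc)

end Homology

/-! ### Persistent vector spaces and their diagrams -/

/-- A persistent vector space: a functor from `(ℝ, ≤)` to vector spaces over `𝕜`. -/
structure PersistentVectorSpace (𝕜 : Type w) [Field 𝕜] : Type (max w (v + 1)) where
  U : ℝ → Type v
  [addCommGroup : ∀ t, AddCommGroup (U t)]
  [module : ∀ t, Module 𝕜 (U t)]
  map : ∀ {s t : ℝ}, s ≤ t → U s →ₗ[𝕜] U t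
  map_id : ∀ t, map (le_refl t) = LinearMap.id
  map_comp : ∀ {r s t : ℝ} (h : r ≤ s) (h' : s ≤ t), map (h.trans h') = map h' ∘ₗ map h

attribute [instance] PersistentVectorSpace.addCommGroup PersistentVectorSpace.module

/-- The `k`-th persistent homology of a filtered space. -/
def persistentHomology (𝕜 : Type w) [Field 𝕜] {X : Type u} [Finite X] (φ : Filtration X) (k : ℕ) :
    PersistentVectorSpace.{max u w} 𝕜 :=
  letI : Fintype X := Fintype.ofFinite X
  { U := fun t => homology 𝕜 (φ.complex t) k
    map := fun h => homologyMap 𝕜 (φ.complex_mono h) k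
    map_id := fun t => by
      ext c
      rfl
    map_comp := fun h h' => by
      ext c
      rfl }

/-- A bar `[birth, death)`, where `birth < death ≤ ∞`. -/
structure Bar where
  birth : ℝ
  death : WithTop ℝ
  lt : (birth : WithTop ℝ) < death

/-- A persistence diagram: a multiset of bars, given by the multiplicity of each bar. -/
def Diagram : Type := Bar → ℕ

namespace PersistentVectorSpace

variable {𝕜 : Type w} [Field 𝕜] (V : PersistentVectorSpace.{v} 𝕜)

/-- The classes at time `b` that have died at time `d` (all classes, if `d = ∞`). -/
def deadAt (b : ℝ) (d : WithTop ℝ) : Submodule 𝕜 (V.U b) :=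
  ⨅ (t : ℝ) (h : b ≤ t) (_ : d ≤ (t : WithTop ℝ)), LinearMap.ker (V.map h)

/-- The classes at time `b` that have died strictly before time `d`. -/
def deadBefore (b : ℝ) (d : WithTop ℝ) : Submodule 𝕜 (V.U b) :=
  ⨆ (t : ℝ) (h : b ≤ t) (_ : (t : WithTop ℝ) < d), LinearMap.ker (V.map h)

/-- The classes at time `b` that come from times strictly before `b`. -/
def bornBefore (b : ℝ) : Submodule 𝕜 (V.U b) :=
  ⨆ (s : ℝ) (h : s < b), LinearMap.range (V.map h.le)

/-- The persistence diagram (barcode). The multiplicity of `[b, d)` is the dimension of the space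
of classes at time `b` that are dead at time `d`, modulo those that are a sum of a class that is
dead before `d` and a class that is born before `b`. If `V` is a direct sum of interval modules,
finitely many of which are alive at time `b`, then this is the number of summands supported on
exactly `[b, d)`. -/
def dgm : Diagram := fun I =>
  Module.finrank 𝕜
    (V.deadAt I.birth I.death ⧸
      (V.deadBefore I.birth I.death ⊔ V.bornBefore I.birth).submoduleOf
        (V.deadAt I.birth I.death))

end PersistentVectorSpace

/-- `dgm_k^Φ(X)`: the `k`-th persistence diagram of `X` under the filtration functor `Φ`. -/
def FiltrationFunctor.dgm (𝕜 : Type w) [Field 𝕜] (Φ : FiltrationFunctor.{u}) (k : ℕ)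
    (X : FinMet.{u}) : Diagram :=
  (persistentHomology 𝕜 (Φ X) k).dgm

/-! ### The bottleneck distance -/

/-- `|a - b|` on `(-∞, ∞]`, where `|∞ - ∞| = 0` and `|∞ - a| = ∞` for real `a`. -/
def extDist : WithTop ℝ → WithTop ℝ → ℝ≥0∞
  | (a : ℝ), (b : ℝ) => ENNReal.ofReal |a - b|
  | ⊤, ⊤ => 0
  | _, _ => ⊤

/-- The `ℓ^∞` distance between two bars. -/
def Bar.dist (I J : Bar) : ℝ≥0∞ :=
  max (ENNReal.ofReal |I.birth - J.birth|) (extDist I.death J.death)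

/-- The `ℓ^∞` distance of a bar to the diagonal: half its length. -/
def Bar.toDiagonal (I : Bar) : ℝ≥0∞ := extDist I.birth I.death / 2

/-- The points of a diagram, each bar being repeated according to its multiplicity. -/
def Diagram.Point (D : Diagram) : Type := Σ I : Bar, Fin (D I)

/-- The cost of a partial matching `m` of two diagrams: the largest distance between matched bars,
or of an unmatched bar to the diagonal. -/
def matchingCost {D E : Diagram} (m : D.Point ≃. E.Point) : ℝ≥0∞ :=
  (⨆ (p : D.Point) (q : E.Point) (_ : m p = some q), p.1.dist q.1) ⊔
  (⨆ (p : D.Point) (_ : m p = none), p.1.toDiagonal) ⊔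
  (⨆ (q : E.Point) (_ : m.symm q = none), q.1.toDiagonal)

/-- The bottleneck distance (an infimum over all partial matchings; possibly infinite). -/
def bottleneckDist (D E : Diagram) : ℝ≥0∞ :=
  ⨅ m : D.Point ≃. E.Point, matchingCost m

end FiltFunctor

end

namespace FiltFunctor

noncomputable section

/-! ### Diagrams of persistent vector spaces -/

namespace PersistentVectorSpace

variable {𝕜 : Type w} [Field 𝕜] (V : PersistentVectorSpace.{v} 𝕜)

/-! Any one-point `X` and two-point `Y` work. Put `a = d_GH(X, Y)`, which is positive because the
cardinalities differ. The filtration on `X` is identically zero, so in any tripod the simplex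
consisting of all of `Z` contributes at least the largest value of the filtration on `Y`; stability
then bounds every value of that filtration by `a` (`le_filtDist_of_subsingleton`).

In degree 0 all vertices appear at time 0 and the complex is a full simplex from time `a` on. Hence
each diagram has `[0, ∞)` with multiplicity one, and its other bars are `[0, d)` with `d ≤ a`.
Matching the infinite bars and sending the rest to the diagonal costs at most `a / 2 < a`
(`bottleneckDist_persistentHomology_zero_le`). In positive degree at most two vertices carry no
nonzero cycle, so both diagrams are empty and their distance is 0. -/

theorem dgm_eq_zero_of_deadAt_le {I : Bar}
    (h : V.deadAt I.birth I.death ≤ V.deadBefore I.birth I.death ⊔ V.bornBefore I.birth) :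
    V.dgm I = 0 := by
  have : Subsingleton (V.deadAt I.birth I.death ⧸
      (V.deadBefore I.birth I.death ⊔ V.bornBefore I.birth).submoduleOf
        (V.deadAt I.birth I.death)) := by
    rw [Submodule.Quotient.subsingleton_iff]
    exact Submodule.submoduleOf_eq_top.2 h
  exact Module.finrank_zero_of_subsingleton

theorem dgm_eq_zero_of_subsingleton (I : Bar) (h : Subsingleton (V.U I.birth)) :
    V.dgm I = 0 :=
  V.dgm_eq_zero_of_deadAt_le fun x _ => Subsingleton.elim 0 x ▸ Submodule.zero_mem _

theorem ker_le_deadBefore {b t : ℝ} {d : WithTop ℝ} (h : b ≤ t) (ht : (t : WithTop ℝ) < d) :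
    LinearMap.ker (V.map h) ≤ V.deadBefore b d :=
  le_iSup_of_le t <| le_iSup_of_le h <| le_iSup_of_le ht le_rfl

theorem deadAt_le_ker {b t : ℝ} {d : WithTop ℝ} (h : b ≤ t) (ht : d ≤ (t : WithTop ℝ)) :
    V.deadAt b d ≤ LinearMap.ker (V.map h) :=
  iInf_le_of_le t <| iInf_le_of_le h <| iInf_le_of_le ht le_rfl

theorem deadAt_top (b : ℝ) : V.deadAt b ⊤ = ⊤ := by
  simp [deadAt]

theorem bornBefore_eq_bot {b : ℝ} (h : ∀ s < b, Subsingleton (V.U s)) :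
    V.bornBefore b = ⊥ := by
  refine eq_bot_iff.2 (iSup_le fun s => iSup_le fun hs => ?_)
  rintro _ ⟨x, rfl⟩
  have := h s hs
  simp [Subsingleton.elim x 0]

theorem bornBefore_eq_top {s b : ℝ} (h : s < b) (hsurj : Function.Surjective (V.map h.le)) :
    V.bornBefore b = ⊤ :=
  eq_top_iff.2 <| le_iSup_of_le s <| le_iSup_of_le h (LinearMap.range_eq_top.2 hsurj).ge

variable {V}

/-- Nothing lives before `b`, and by surjectivity every class at a later time already comes from
time `b`. -/
theorem birth_eq_of_dgm_ne_zero {b : ℝ} (hneg : ∀ t < b, Subsingleton (V.U t))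
    (hsurj : ∀ (t : ℝ) (h : b ≤ t), Function.Surjective (V.map h)) {I : Bar}
    (hI : V.dgm I ≠ 0) : I.birth = b := by
  by_contra hne
  rcases lt_or_gt_of_ne hne with h | h
  · exact hI (V.dgm_eq_zero_of_subsingleton I (hneg _ h))
  · refine hI (V.dgm_eq_zero_of_deadAt_le ?_)
    rw [V.bornBefore_eq_top h (hsurj _ _)]
    simp

/-- Kernels stop growing at `a`, so a class dead at a finite `d > a` is already dead at `a`,
strictly before `d`. -/
theorem death_of_dgm_ne_zero {a : ℝ} {I : Bar} (ha : I.birth ≤ a)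
    (hker : ∀ (t : ℝ) (h : a ≤ t),
      LinearMap.ker (V.map (ha.trans h)) ≤ LinearMap.ker (V.map ha))
    (hI : V.dgm I ≠ 0) : I.death = ⊤ ∨ I.death ≤ a := by
  by_contra! hcon
  obtain ⟨d, hd⟩ := WithTop.ne_top_iff_exists.1 hcon.1
  have had : a ≤ d := by
    have := hcon.2
    rw [← hd] at this
    exact (WithTop.coe_lt_coe.1 this).le
  refine hI (V.dgm_eq_zero_of_deadAt_le (le_sup_of_le_left ?_))
  exact ((V.deadAt_le_ker (ha.trans had) hd.ge).trans (hker d had)).trans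
    (V.ker_le_deadBefore ha hcon.2)

/-- The two inclusions make `ker ε` exactly the space of classes that eventually die. No class is
born before `b`, so the quotient defining the multiplicity is identified with `𝕜` by `ε`. -/
theorem dgm_top_eq_one {b a : ℝ} (hneg : ∀ t < b, Subsingleton (V.U t)) (ε : V.U b →ₗ[𝕜] 𝕜)
    (hε : Function.Surjective ε)
    (hle : ∀ (t : ℝ) (h : b ≤ t), LinearMap.ker (V.map h) ≤ LinearMap.ker ε)
    (ha : b ≤ a) (hge : LinearMap.ker ε ≤ LinearMap.ker (V.map ha)) :
    V.dgm ⟨b, ⊤, WithTop.coe_lt_top b⟩ = 1 := by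
  have hdead : V.deadBefore b ⊤ ⊔ V.bornBefore b = LinearMap.ker ε := by
    rw [V.bornBefore_eq_bot hneg, sup_bot_eq]
    refine le_antisymm (iSup_le fun t => iSup_le fun h => iSup_le fun _ => hle t h) ?_
    exact hge.trans (V.ker_le_deadBefore ha (WithTop.coe_lt_top a))
  let f : V.deadAt b ⊤ →ₗ[𝕜] 𝕜 := ε ∘ₗ (V.deadAt b ⊤).subtype
  have hf : Function.Surjective f := fun r => by
    obtain ⟨x, hx⟩ := hε r
    exact ⟨⟨x, by rw [deadAt_top]; trivial⟩, hx⟩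
  have hkf : (V.deadBefore b ⊤ ⊔ V.bornBefore b).submoduleOf (V.deadAt b ⊤) =
      LinearMap.ker f := by
    rw [hdead, LinearMap.ker_comp]
    rfl
  change Module.finrank 𝕜 (V.deadAt b ⊤ ⧸
    (V.deadBefore b ⊤ ⊔ V.bornBefore b).submoduleOf (V.deadAt b ⊤)) = 1
  rw [hkf, (f.quotKerEquivOfSurjective hf).finrank_eq, Module.finrank_self]

end PersistentVectorSpace

/-! ### Homology of complexes -/

section Homology

variable {𝕜 : Type w} [Field 𝕜] {X : Type u}

theorem vertices_nonempty {n : ℕ} (x : Fin (n + 1) → X) : (vertices x).Nonempty :=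
  ⟨x 0, by simp [vertices]⟩

theorem chains_eq_bot {K : PreAbstractSimplicialComplex X} (hK : K.faces = ∅) (k : ℕ) :
    chains 𝕜 K k = ⊥ :=
  eq_bot_iff.2 fun _ hc => (Submodule.mem_bot _).2 <| funext fun x => hc.2.2 x (by simp [hK])

theorem vertices_fin_one (x : Fin 1 → X) : vertices x = {x 0} := by
  ext y
  simp [vertices]

variable [Fintype X]

theorem cycles_le_chains (K : PreAbstractSimplicialComplex X) (k : ℕ) :
    cycles (𝕜 := 𝕜) K k ≤ chains 𝕜 K k := by
  cases k with
  | zero => exact le_rfl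
  | succ k => exact inf_le_left

theorem homology_subsingleton_of_cycles_eq_bot {K : PreAbstractSimplicialComplex X} {k : ℕ}
    (h : cycles (𝕜 := 𝕜) K k = ⊥) : Subsingleton (homology 𝕜 K k) := by
  have : Subsingleton (cycles (𝕜 := 𝕜) K k) := (Submodule.subsingleton_iff_eq_bot).2 h
  exact (Submodule.Quotient.mk_surjective _).subsingleton

/-- A complex with at most two vertices has no cycles in positive degree. -/
theorem cycles_succ_eq_bot_of_card_le_two (hX : Fintype.card X ≤ 2)
    (K : PreAbstractSimplicialComplex X) (k : ℕ) : cycles (𝕜 := 𝕜) K (k + 1) = ⊥ := by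
  refine eq_bot_iff.2 fun c hc => (Submodule.mem_bot _).2 <| funext fun z => ?_
  obtain ⟨⟨hinj, -, -⟩, hb⟩ := hc
  by_contra hz
  have hzinj : Function.Injective z := by
    by_contra h
    exact hz (hinj z h)
  have hcard := Fintype.card_le_of_injective z hzinj
  have hcardX : Fintype.card X = Fintype.card (Fin (k + 2)) := by
    simp only [Fintype.card_fin] at hcard ⊢
    omega
  have hsurj : Function.Surjective z :=
    ((Fintype.bijective_iff_injective_and_card z).2 ⟨hzinj, hcardX.symm⟩).2
  -- The tuple `z` lists all vertices, so in the boundary at the face opposite `z 0` every term but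
  -- `c z` repeats a vertex and vanishes.
  have hsum : ∑ x : X, c (Fin.cons x (Fin.tail z)) = 0 := congrFun hb (Fin.tail z)
  rw [Finset.sum_eq_single (z 0), Fin.cons_self_tail] at hsum
  · exact hz hsum
  · intro x _ hx
    refine hinj _ fun h => ?_
    obtain ⟨i, rfl⟩ := hsurj x
    obtain ⟨j, rfl⟩ := Fin.exists_succ_eq.2 (fun hi => hx (by rw [hi]) : i ≠ 0)
    have := @h 0 j.succ (by simp [Fin.tail])
    exact Fin.succ_ne_zero j this.symm
  · simp

variable (𝕜 X) in
/-- The sum of the coefficients of a `0`-chain. -/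
def augmentation : ((Fin 1 → X) → 𝕜) →ₗ[𝕜] 𝕜 where
  toFun c := ∑ x : X, c fun _ => x
  map_add' a b := by simp [Finset.sum_add_distrib]
  map_smul' r a := by simp [Finset.mul_sum]

/-- Swapping the two vertices cancels terms in pairs by antisymmetry; the diagonal terms vanish. -/
theorem augmentation_boundary {K : PreAbstractSimplicialComplex X} {c : (Fin 2 → X) → 𝕜}
    (hc : c ∈ chains 𝕜 K 1) : augmentation 𝕜 X (boundary 𝕜 0 c) = 0 := by
  obtain ⟨h1, h2, -⟩ := hc
  change ∑ y : X, ∑ x : X, c (Fin.cons x fun _ => y) = 0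
  rw [← Finset.sum_product' Finset.univ Finset.univ (fun y x => c (Fin.cons x fun _ => y))]
  refine Finset.sum_involution (fun p _ => (p.2, p.1)) ?_ ?_ (by simp) (by simp)
  · rintro ⟨y, x⟩ -
    have h := h2 (Fin.cons x fun _ => y) (Equiv.swap 0 1)
    have he : (Fin.cons x (fun _ => y) : Fin 2 → X) ∘ Equiv.swap 0 1 =
        Fin.cons y fun _ => x := by
      funext i
      fin_cases i <;> rfl
    rw [he] at h
    simp [h]
  · rintro ⟨y, x⟩ - hne heq
    refine hne (h1 _ fun hinj => ?_)
    have hx : x = y := (Prod.mk.inj heq).1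
    have := @hinj 0 1 hx
    simp at this

/-- In a full simplex, every `0`-chain whose coefficients sum up to zero is a boundary. -/
theorem mem_boundaries_of_augmentation_eq_zero [Nonempty X] {K : PreAbstractSimplicialComplex X}
    (hK : ∀ σ : Finset X, σ.Nonempty → σ ∈ K.faces) {f : (Fin 1 → X) → 𝕜}
    (hf : augmentation 𝕜 X f = 0) : f ∈ boundaries (𝕜 := 𝕜) K 0 := by
  classical
  let x₀ : X := Classical.arbitrary X
  -- The cone over `f` with apex `x₀`, that is `∑ f(x) [x₀, x]` as an alternating function. Its
  -- boundary is `f` minus the coefficient sum of `f` times `[x₀]`.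
  let c : (Fin 2 → X) → 𝕜 := fun z =>
    (if z 0 = x₀ then f (fun _ => z 1) else 0) - (if z 1 = x₀ then f (fun _ => z 0) else 0)
  have hrep : ∀ z : Fin 2 → X, z 0 = z 1 → c z = 0 := fun z hz => by simp [c, hz]
  refine ⟨c, ⟨fun z hz => hrep z ?_, fun z π => ?_, fun z hz => ?_⟩, ?_⟩
  · by_contra hne
    refine hz fun i j hij => ?_
    fin_cases i <;> fin_cases j <;> simp_all
  · have hπ : ∀ π : Equiv.Perm (Fin 2), π = 1 ∨ π = Equiv.swap 0 1 := by decide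
    rcases hπ π with rfl | rfl
    · simp
    · rw [Equiv.Perm.sign_swap (by decide)]
      simp [c]
  · exact absurd (hK _ (vertices_nonempty z)) hz
  · funext y
    have hy : y = fun _ => y 0 := funext fun i => by rw [Subsingleton.elim (α := Fin 1) i 0]
    have hf' : ∑ x : X, f (fun _ => x) = 0 := hf
    change ∑ x : X, c (Fin.cons x y) = f y
    have : ∀ x : X, c (Fin.cons x y) =
        (if x = x₀ then f y else 0) - (if y 0 = x₀ then f (fun _ => x) else 0) := fun x => by
      rw [hy]
      rfl
    simp only [this, Finset.sum_sub_distrib, Finset.sum_ite_eq', Finset.mem_univ, if_true]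
    split_ifs <;> simp [hf']

variable (𝕜) in
/-- The augmentation of the zeroth homology. -/
def homologyAugmentation (K : PreAbstractSimplicialComplex X) : homology 𝕜 K 0 →ₗ[𝕜] 𝕜 :=
  Submodule.liftQ _ (augmentation 𝕜 X ∘ₗ (cycles (𝕜 := 𝕜) K 0).subtype) <| by
    rintro ⟨_, _⟩ ⟨c, hc, rfl⟩
    exact augmentation_boundary hc

theorem homologyAugmentation_homologyMap {K L : PreAbstractSimplicialComplex X} (h : K ≤ L)
    (z : homology 𝕜 K 0) :
    homologyAugmentation 𝕜 L (homologyMap 𝕜 h 0 z) = homologyAugmentation 𝕜 K z := by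
  obtain ⟨c, rfl⟩ := Submodule.Quotient.mk_surjective _ z
  rfl

theorem homologyAugmentation_injective [Nonempty X] {K : PreAbstractSimplicialComplex X}
    (hK : ∀ σ : Finset X, σ.Nonempty → σ ∈ K.faces) :
    Function.Injective (homologyAugmentation 𝕜 K) := by
  refine (injective_iff_map_eq_zero _).2 fun z hz => ?_
  obtain ⟨c, rfl⟩ := Submodule.Quotient.mk_surjective _ z
  exact (Submodule.Quotient.mk_eq_zero _).2 (mem_boundaries_of_augmentation_eq_zero hK hz)

theorem mem_cycles_zero {K : PreAbstractSimplicialComplex X} (hK : ∀ x : X, {x} ∈ K.faces)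
    (c : (Fin 1 → X) → 𝕜) : c ∈ cycles (𝕜 := 𝕜) K 0 := by
  refine ⟨fun x hx => absurd (Function.injective_of_subsingleton (α := Fin 1) x) hx, fun x π => ?_,
    fun x hx => absurd (hK (x 0)) (by rwa [← vertices_fin_one])⟩
  simp [Subsingleton.elim (α := Equiv.Perm (Fin 1)) π 1]

theorem homologyAugmentation_surjective [Nonempty X] {K : PreAbstractSimplicialComplex X}
    (hK : ∀ x : X, {x} ∈ K.faces) : Function.Surjective (homologyAugmentation 𝕜 K) := by
  classical
  intro r
  let x₀ : X := Classical.arbitrary X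
  let c : (Fin 1 → X) → 𝕜 := fun x => if x 0 = x₀ then r else 0
  refine ⟨Submodule.Quotient.mk ⟨c, mem_cycles_zero hK c⟩, ?_⟩
  change ∑ x : X, c (fun _ => x) = r
  simp [c]

/-- All vertices are already in `K`, so any 0-chain of `L` is a cycle of `K`. -/
theorem homologyMap_zero_surjective {K L : PreAbstractSimplicialComplex X} (h : K ≤ L)
    (hK : ∀ x : X, {x} ∈ K.faces) : Function.Surjective (homologyMap 𝕜 h 0) := by
  intro z
  obtain ⟨c, rfl⟩ := Submodule.Quotient.mk_surjective _ z
  exact ⟨Submodule.Quotient.mk ⟨c.1, mem_cycles_zero hK c.1⟩, rfl⟩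

end Homology

/-! ### Persistent homology of filtered spaces -/

section Filtration

variable {𝕜 : Type w} [Field 𝕜] {X : Type u} (φ : Filtration X)

theorem Filtration.complex_faces_eq_empty {t : ℝ} (ht : t < 0) : (φ.complex t).faces = ∅ := by
  refine Set.eq_empty_of_forall_notMem fun σ hσ => ?_
  obtain ⟨h, hle⟩ := hσ
  exact absurd (hle.trans_lt ht) (not_lt.2 (NNReal.coe_nonneg _))

theorem Filtration.singleton_mem_complex
    (hφ : ∀ x : X, φ.toFun ⟨{x}, Finset.singleton_nonempty x⟩ = 0) {t : ℝ} (ht : 0 ≤ t) (x : X) :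
    {x} ∈ (φ.complex t).faces :=
  ⟨Finset.singleton_nonempty x, by rw [hφ x]; exact_mod_cast ht⟩

theorem Filtration.mem_complex_of_le {a t : ℝ} (ha : ∀ σ, (φ.toFun σ : ℝ) ≤ a) (ht : a ≤ t)
    (σ : Finset X) (hσ : σ.Nonempty) : σ ∈ (φ.complex t).faces :=
  ⟨hσ, (ha _).trans ht⟩

variable [Finite X]

theorem persistentHomology_subsingleton_of_neg (k : ℕ) {t : ℝ} (ht : t < 0) :
    Subsingleton ((persistentHomology 𝕜 φ k).U t) := by
  let _ : Fintype X := Fintype.ofFinite X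
  refine homology_subsingleton_of_cycles_eq_bot (𝕜 := 𝕜) (K := φ.complex t) (k := k) ?_
  exact eq_bot_iff.2 ((cycles_le_chains _ _).trans
    (chains_eq_bot (φ.complex_faces_eq_empty ht) k).le)

theorem persistentHomology_zero_map_surjective
    (hφ : ∀ x : X, φ.toFun ⟨{x}, Finset.singleton_nonempty x⟩ = 0) (t : ℝ) (h : 0 ≤ t) :
    Function.Surjective ((persistentHomology 𝕜 φ 0).map h) := by
  let _ : Fintype X := Fintype.ofFinite X
  exact homologyMap_zero_surjective (φ.complex_mono h) (φ.singleton_mem_complex hφ le_rfl)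

/-- The maps preserve the augmentation, so a class that dies has augmentation zero; from time `a` on
the complex is a full simplex, where the augmentation is injective. -/
theorem exists_augmentation [Nonempty X]
    (hφ : ∀ x : X, φ.toFun ⟨{x}, Finset.singleton_nonempty x⟩ = 0) {a : ℝ}
    (ha : ∀ σ, (φ.toFun σ : ℝ) ≤ a) :
    ∃ ε : (persistentHomology 𝕜 φ 0).U 0 →ₗ[𝕜] 𝕜, Function.Surjective ε ∧
      (∀ (t : ℝ) (h : 0 ≤ t),
        LinearMap.ker ((persistentHomology 𝕜 φ 0).map h) ≤ LinearMap.ker ε) ∧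
      ∀ (t : ℝ) (h : 0 ≤ t), a ≤ t →
        LinearMap.ker ε ≤ LinearMap.ker ((persistentHomology 𝕜 φ 0).map h) := by
  let _ : Fintype X := Fintype.ofFinite X
  refine ⟨homologyAugmentation 𝕜 (φ.complex 0),
    homologyAugmentation_surjective (φ.singleton_mem_complex hφ le_rfl), fun t h z hz => ?_,
    fun t h hat z hz => ?_⟩
  · have hz' : homologyMap 𝕜 (φ.complex_mono h) 0 z = 0 := hz
    have := homologyAugmentation_homologyMap (φ.complex_mono h) z
    rw [hz', map_zero] at this
    exact this.symm
  · refine homologyAugmentation_injective (φ.mem_complex_of_le ha hat)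
      (((homologyAugmentation_homologyMap (φ.complex_mono h) z).trans hz).trans ?_)
    exact (map_zero _).symm

theorem bar_of_persistentHomology_zero_dgm_ne_zero [Nonempty X]
    (hφ : ∀ x : X, φ.toFun ⟨{x}, Finset.singleton_nonempty x⟩ = 0) {a : ℝ} (ha₀ : 0 ≤ a)
    (ha : ∀ σ, (φ.toFun σ : ℝ) ≤ a) {I : Bar} (hI : (persistentHomology 𝕜 φ 0).dgm I ≠ 0) :
    I.birth = 0 ∧ (I.death = ⊤ ∨ I.death ≤ a) := by
  have hb : I.birth = 0 := PersistentVectorSpace.birth_eq_of_dgm_ne_zero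
    (fun t ht => persistentHomology_subsingleton_of_neg φ 0 ht)
    (persistentHomology_zero_map_surjective φ hφ) hI
  refine ⟨hb, ?_⟩
  obtain ⟨b, d, hbd⟩ := I
  obtain rfl : b = 0 := hb
  obtain ⟨ε, -, hle, hge⟩ := exists_augmentation (𝕜 := 𝕜) φ hφ ha
  -- Kernels stabilise at `a` because `ker ε` lies between the kernel at `t` and the kernel at `a`.
  exact PersistentVectorSpace.death_of_dgm_ne_zero ha₀
    (fun t h => (hle t _).trans (hge a ha₀ le_rfl)) hI

theorem persistentHomology_zero_dgm_top [Nonempty X]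
    (hφ : ∀ x : X, φ.toFun ⟨{x}, Finset.singleton_nonempty x⟩ = 0) {a : ℝ} (ha₀ : 0 ≤ a)
    (ha : ∀ σ, (φ.toFun σ : ℝ) ≤ a) :
    (persistentHomology 𝕜 φ 0).dgm ⟨0, ⊤, WithTop.coe_lt_top 0⟩ = 1 := by
  obtain ⟨ε, hε, hle, hge⟩ := exists_augmentation (𝕜 := 𝕜) φ hφ ha
  exact PersistentVectorSpace.dgm_top_eq_one
    (fun t ht => persistentHomology_subsingleton_of_neg φ 0 ht) ε hε hle ha₀ (hge a ha₀ le_rfl)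

theorem persistentHomology_succ_dgm_eq_zero (hX : Nat.card X ≤ 2) (k : ℕ) (I : Bar) :
    (persistentHomology 𝕜 φ (k + 1)).dgm I = 0 := by
  let _ : Fintype X := Fintype.ofFinite X
  refine PersistentVectorSpace.dgm_eq_zero_of_subsingleton _ I ?_
  exact homology_subsingleton_of_cycles_eq_bot (𝕜 := 𝕜) (K := φ.complex I.birth) (k := k + 1)
    (cycles_succ_eq_bot_of_card_le_two (Nat.card_eq_fintype_card (α := X) ▸ hX) _ _)

end Filtration

/-! ### Bounds for the bottleneck distance -/

theorem bottleneckDist_eq_zero_of_eq_zero {D E : Diagram} (hD : ∀ I, D I = 0)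
    (hE : ∀ I, E I = 0) : bottleneckDist D E = 0 := by
  have : IsEmpty D.Point := ⟨fun p => (Fin.cast (hD p.1) p.2).elim0⟩
  have : IsEmpty E.Point := ⟨fun p => (Fin.cast (hE p.1) p.2).elim0⟩
  refine le_antisymm (iInf_le_of_le ⊥ ?_) zero_le
  simp [matchingCost]

theorem Bar.dist_self (I : Bar) : I.dist I = 0 := by
  obtain ⟨b, d, h⟩ := I
  induction d using WithTop.recTopCoe with
  | top => simp [Bar.dist, extDist]
  | coe d => simp [Bar.dist, extDist]

theorem Bar.toDiagonal_le {I : Bar} {a : ℝ} (hb : 0 ≤ I.birth) (hd : I.death ≤ a) :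
    I.toDiagonal ≤ ENNReal.ofReal a / 2 := by
  obtain ⟨b, d, h⟩ := I
  induction d using WithTop.recTopCoe with
  | top => simp at hd
  | coe d =>
    have hbd : b < d := WithTop.coe_lt_coe.1 h
    have hda : d ≤ a := WithTop.coe_le_coe.1 hd
    have hb' : 0 ≤ b := hb
    refine ENNReal.div_le_div_right (ENNReal.ofReal_le_ofReal ?_) 2
    rw [abs_sub_comm, abs_of_pos (sub_pos.2 hbd)]
    linarith

/-- Match the unique copies of `I` at cost 0 and leave everything else unmatched. -/
theorem bottleneckDist_le_of_single {D E : Diagram} (I : Bar) (hD : D I = 1) (hE : E I = 1)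
    {r : ℝ≥0∞} (hD' : ∀ J, D J ≠ 0 → J ≠ I → J.toDiagonal ≤ r)
    (hE' : ∀ J, E J ≠ 0 → J ≠ I → J.toDiagonal ≤ r) : bottleneckDist D E ≤ r := by
  classical
  have key : ∀ {F : Diagram} (hF : F I = 1) (p : F.Point), p.1 = I →
      p = ⟨I, Fin.cast hF.symm 0⟩ := by
    rintro F hF ⟨J, i⟩ rfl
    have : Subsingleton (Fin (F J)) := by rw [hF]; infer_instance
    exact congrArg (Sigma.mk J) (Subsingleton.elim _ _)
  have hne : ∀ {F : Diagram} (p : F.Point), F p.1 ≠ 0 := fun p h => (Fin.cast h p.2).elim0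
  let p₀ : D.Point := ⟨I, Fin.cast hD.symm 0⟩
  let q₀ : E.Point := ⟨I, Fin.cast hE.symm 0⟩
  refine iInf_le_of_le (PEquiv.single p₀ q₀) (sup_le (sup_le ?_ ?_) ?_)
  · refine iSup_le fun p => iSup_le fun q => iSup_le fun h => ?_
    obtain ⟨rfl, rfl⟩ := (PEquiv.mem_single_iff p p₀ q q₀).1 h
    exact (Bar.dist_self I).le.trans zero_le
  · refine iSup_le fun p => iSup_le fun h => hD' p.1 (hne p) fun hp => ?_
    rw [key hD p hp, PEquiv.single_apply] at h
    cases h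
  · refine iSup_le fun q => iSup_le fun h => hE' q.1 (hne q) fun hq => ?_
    rw [key hE q hq, PEquiv.symm_single, PEquiv.single_apply] at h
    cases h

/-- Two filtered spaces whose vertices all arrive at time zero and whose simplices have all arrived
at time `a` have degree zero diagrams of bottleneck distance at most `a / 2`. -/
theorem bottleneckDist_persistentHomology_zero_le {𝕜 : Type w} [Field 𝕜] {X Y : Type u} [Finite X]
    [Nonempty X] [Finite Y] [Nonempty Y] (φ : Filtration X) (ψ : Filtration Y)
    (hφ : ∀ x : X, φ.toFun ⟨{x}, Finset.singleton_nonempty x⟩ = 0)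
    (hψ : ∀ y : Y, ψ.toFun ⟨{y}, Finset.singleton_nonempty y⟩ = 0) {a : ℝ} (ha₀ : 0 ≤ a)
    (hφa : ∀ σ, (φ.toFun σ : ℝ) ≤ a) (hψa : ∀ σ, (ψ.toFun σ : ℝ) ≤ a) :
    bottleneckDist (persistentHomology 𝕜 φ 0).dgm (persistentHomology 𝕜 ψ 0).dgm ≤
      ENNReal.ofReal a / 2 := by
  have aux : ∀ {J : Bar}, J.birth = 0 ∧ (J.death = ⊤ ∨ J.death ≤ a) →
      J ≠ ⟨0, ⊤, WithTop.coe_lt_top 0⟩ → J.toDiagonal ≤ ENNReal.ofReal a / 2 := by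
    rintro ⟨b, d, h⟩ ⟨rfl, rfl | hd⟩ hJ
    · exact absurd rfl hJ
    · exact Bar.toDiagonal_le le_rfl hd
  exact bottleneckDist_le_of_single _ (persistentHomology_zero_dgm_top φ hφ ha₀ hφa)
    (persistentHomology_zero_dgm_top ψ hψ ha₀ hψa)
    (fun J hJ => aux (bar_of_persistentHomology_zero_dgm_ne_zero φ hφ ha₀ hφa hJ))
    (fun J hJ => aux (bar_of_persistentHomology_zero_dgm_ne_zero ψ hψ ha₀ hψa hJ))

/-! ### Distances from a one-point space -/

/-- The filtration distance from a one-point space bounds all filtration values. -/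
theorem le_filtDist_of_subsingleton {X Y : Type u} [Subsingleton X] [Nonempty X] [Finite Y]
    (φ : Filtration X) (ψ : Filtration Y)
    (hφ : ∀ x : X, φ.toFun ⟨{x}, Finset.singleton_nonempty x⟩ = 0) (σ : Pow Y) :
    (ψ.toFun σ : ℝ) ≤ filtDist φ ψ := by
  classical
  have hφ0 : ∀ τ : Pow X, φ.toFun τ = 0 := by
    rintro ⟨τ, x, hx⟩
    have : τ = {x} := Finset.eq_singleton_iff_unique_mem.2 ⟨hx, fun y _ => Subsingleton.elim y x⟩
    subst this
    exact hφ x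
  let x₀ : X := Classical.arbitrary X
  -- A real infimum over an empty family would be 0, so the lower bound needs some tripod: `Z = Y`
  -- serves.
  have : Nonempty (Tripod X Y) := by
    have : Nonempty Y := ⟨σ.2.choose⟩
    exact ⟨⟨Y, fun _ => x₀, id, fun x => ⟨Classical.arbitrary Y, Subsingleton.elim _ _⟩,
      Function.surjective_id⟩⟩
  refine le_ciInf fun T => ?_
  have := T.finite
  let _ : Fintype T.Z := Fintype.ofFinite T.Z
  obtain ⟨z₀, -⟩ := T.left_surj x₀
  -- Testing on all of `Z`: its image in `Y` is everything, hence contains `σ`, while the value on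
  -- the `X` side is 0.
  let ρ : Pow T.Z := ⟨Finset.univ, z₀, Finset.mem_univ z₀⟩
  have hσ : ψ.toFun σ ≤ ψ.toFun (ρ.image T.right) := by
    refine ψ.mono _ _ fun y _ => ?_
    obtain ⟨z, rfl⟩ := T.right_surj y
    simp [Pow.image, ρ]
  have hfin : Finite (Pow T.Z) := inferInstance
  refine le_trans ?_ (le_ciSup (Set.finite_range _).bddAbove ρ)
  rw [hφ0, NNReal.coe_zero, zero_sub, abs_neg, abs_of_nonneg (NNReal.coe_nonneg _)]
  exact_mod_cast hσ

/-- Compact spaces at Gromov–Hausdorff distance zero are isometric, hence equinumerous. -/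
theorem ghDist_pos_of_card_ne (X Y : FinMet.{u}) (h : Nat.card X ≠ Nat.card Y) :
    0 < GromovHausdorff.ghDist X Y := by
  refine dist_pos.2 fun he => h ?_
  obtain ⟨e⟩ := GromovHausdorff.toGHSpace_eq_toGHSpace_iff_isometryEquiv.1 he
  exact Nat.card_congr e.toEquiv

theorem bottleneckDist_lt_ghDist_of_card {𝕜 : Type w} [Field 𝕜] {Φ : FiltrationFunctor.{u}}
    (hstable : Φ.IsStable 1)
    (hzero : ∀ (X : FinMet.{u}) (x : X), (Φ X).toFun ⟨{x}, Finset.singleton_nonempty x⟩ = 0)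
    (k : ℕ) (X Y : FinMet.{u}) (hX : Nat.card X = 1) (hY : Nat.card Y = 2) :
    bottleneckDist (Φ.dgm 𝕜 k X) (Φ.dgm 𝕜 k Y) <
      ENNReal.ofReal (GromovHausdorff.ghDist X Y) := by
  have hpos : 0 < GromovHausdorff.ghDist X Y := ghDist_pos_of_card_ne X Y (by omega)
  cases k with
  | zero =>
    have : Subsingleton X := (Nat.card_eq_one_iff_unique.1 hX).1
    have hle : filtDist (Φ X) (Φ Y) ≤ GromovHausdorff.ghDist X Y := by
      simpa using hstable X Y
    have hXa : ∀ σ, ((Φ X).toFun σ : ℝ) ≤ GromovHausdorff.ghDist X Y := by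
      rintro ⟨σ, x, hx⟩
      have : σ = {x} := Finset.eq_singleton_iff_unique_mem.2 ⟨hx, fun y _ => Subsingleton.elim y x⟩
      subst this
      rw [hzero X x]
      exact hpos.le
    refine (bottleneckDist_persistentHomology_zero_le (Φ X) (Φ Y) (hzero X) (hzero Y) hpos.le hXa
      fun σ => (le_filtDist_of_subsingleton (Φ X) (Φ Y) (hzero X) σ).trans hle).trans_lt ?_
    -- The strict inequality comes from the factor 1/2 in the distance to the diagonal.
    exact ENNReal.half_lt_self (ENNReal.ofReal_pos.2 hpos).ne' ENNReal.ofReal_ne_top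
  | succ k =>
    have h0 : bottleneckDist (Φ.dgm 𝕜 (k + 1) X) (Φ.dgm 𝕜 (k + 1) Y) = 0 :=
      bottleneckDist_eq_zero_of_eq_zero
        (persistentHomology_succ_dgm_eq_zero (Φ X) (by omega) k)
        (persistentHomology_succ_dgm_eq_zero (Φ Y) (by omega) k)
    rw [h0]
    exact ENNReal.ofReal_pos.2 hpos

end

end FiltFunctor

theorem mainTheorem4 (𝕜 : Type w) [Field 𝕜]
    (Φ : FiltFunctor.FiltrationFunctor.{u})
    (hstable : Φ.IsStable 1)
    (hzero : ∀ (X : FiltFunctor.FinMet.{u}) (x : X),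
      (Φ X).toFun ⟨{x}, Finset.singleton_nonempty x⟩ = 0)
    (k : ℕ) :
    ∃ X Y : FiltFunctor.FinMet.{u},
      Nat.card X = 1 ∧ Nat.card Y = 2 ∧
      FiltFunctor.bottleneckDist (Φ.dgm 𝕜 k X) (Φ.dgm 𝕜 k Y) <
        ENNReal.ofReal (GromovHausdorff.ghDist X Y) := by
  have hX : Nat.card PUnit.{u + 1} = 1 := by simp
  have hY : Nat.card (ULift.{u} ({0, 1} : Set ℝ)) = 2 := by
    rw [Nat.card_congr Equiv.ulift, Nat.card_coe_set_eq, Set.ncard_pair zero_ne_one]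
  have : Finite ({0, 1} : Set ℝ) := (Set.toFinite _).to_subtype
  -- The pair `{0, 1}` is an arbitrary choice; `ULift` only moves it to the required universe.
  exact ⟨⟨PUnit.{u + 1}⟩, ⟨ULift.{u} ({0, 1} : Set ℝ)⟩, hX, hY,
    FiltFunctor.bottleneckDist_lt_ghDist_of_card hstable hzero k _ _ hX hY⟩
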